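/- For a closed set $\mathcal S\subseteq\mathbb R^d$, let $\pi_{\mathcal S}(x)$ be the set of points of $\mathcal S$ closest to $x$, and let the medial axis $\mathrm{ax}(\mathcal S)$ be the set of points $x\in\mathbb R^d$ for which $\pi_{\mathcal S}(x)$ has more than one element. Let $d_H(A,B)=\max\{\sup_{a\in A}d(a,B),\sup_{b\in B}d(b,A)\}\in[0,\infty]$ be the Hausdorff distance (it is $0$ if both sets are empty and $\infty$ if exactly one is). A map is $C^{1,1}$ if it is $C^1$ with Lipschitz derivative, and $\mathrm{Lip}(D\varphi)=\sup_{x\ne y}\|D\varphi(x)-D\varphi(y)\|/|x-y|$, with the operator norm induced by the Euclidean norm. **Theorem.** Let $B\subseteq\mathbb R^d$ be a closed ball of radius $r>0$, and let $\mathcal S\subseteq\mathbb R^d$ be a closed set with $\partial B\subseteq\mathcal S\subseteq B$. Let $\mathcal U$ be the vector space of $C^{1,1}$ maps $\mathbb R^d\to\mathbb R^d$ that vanish outside $B$, normed by $\varphi\mapsto\mathrm{Lip}(D\varphi)$. (i) Let $F=\mathrm{Id}+\varphi$ be a bijection of $\mathbb R^d$ with inverse $\mathrm{Id}+\tilde\varphi$,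 where $\varphi,\tilde\varphi\in\mathcal U$, and put $\varepsilon(F)=\max(\mathrm{Lip}(D\varphi),\mathrm{Lip}(D\tilde\varphi))$. If $r\,\varepsilon(F)\le 1/4$, then $$d_H(\mathrm{ax}(\mathcal S),\mathrm{ax}(F(\mathcal S)))\le(1+\sqrt{50})\,r^2\varepsilon(F)+C\,r^3\varepsilon(F)^2 ,$$ and in particular $d_H(\mathrm{ax}(\mathcal S),\mathrm{ax}(F(\mathcal S)))\le C'\,r^2\varepsilon(F)$. Here $C,C'\ge0$ are absolute constants, independent of $d$, $r$, $B$, $\mathcal S$ and $F$. (ii) The map $F\mapsto\overline{\mathrm{ax}(F(\mathcal S))}$ is Lipschitz for the norm $\mathrm{Lip}(D\,\cdot)$ on every set of diffeomorphisms on which $r\,\varepsilon(F)$ is bounded: for every $M$ there is a constant $C_M\ge0$, depending only on $M$, such that for all $F_1=\mathrm{Id}+\varphi_1$ and $F_2=\mathrm{Id}+\varphi_2$ as in (i), with $r\,\varepsilon(F_1)\le M$ and $r\,\varepsilon(F_2)\le M$ in place of the bound $1/4$, $$d_H\bigl(\overline{\mathrm{ax}(F_1(\mathcal S))},\overline{\mathrm{ax}(F_2(\mathcal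 S))}\bigr)\le C_M\,r^2\,\mathrm{Lip}(D(\varphi_1-\varphi_2)).$$ -/

import Mathlib

/-- The set `π_S(x)` of points of `S` closest to `x`. -/
def closestPoints {d : ℕ} (S : Set (EuclideanSpace ℝ (Fin d))) (x : EuclideanSpace ℝ (Fin d)) :
    Set (EuclideanSpace ℝ (Fin d)) :=
  {q | q ∈ S ∧ ∀ s ∈ S, dist x q ≤ dist x s}

/-- The medial axis `ax(S)`: the points of the ambient space with more than one closest point
in `S`. -/
def medialAxis {d : ℕ} (S : Set (EuclideanSpace ℝ (Fin d))) : Set (EuclideanSpace ℝ (Fin d)) :=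
  {x | 1 < (closestPoints S x).encard}

/-- A `C^{1,1}` map: continuously differentiable with Lipschitz derivative (for the operator norm
on linear maps). -/
def IsC11 {d : ℕ} (φ : EuclideanSpace ℝ (Fin d) → EuclideanSpace ℝ (Fin d)) : Prop :=
  ContDiff ℝ 1 φ ∧ ∃ K : NNReal, LipschitzWith K (fderiv ℝ φ)

/-- `Lip(Dφ)`, the supremum over `x ≠ y` of `‖Dφ(x) - Dφ(y)‖ / |x - y|`, with the operator norm.
The quotients are bounded when `φ` is `C^{1,1}`; the supremum is `0` in dimension `0`. -/
noncomputable def lipDeriv {d : ℕ}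
    (φ : EuclideanSpace ℝ (Fin d) → EuclideanSpace ℝ (Fin d)) : ℝ :=
  ⨆ p : {p : EuclideanSpace ℝ (Fin d) × EuclideanSpace ℝ (Fin d) // p.1 ≠ p.2},
    ‖fderiv ℝ φ p.1.1 - fderiv ℝ φ p.1.2‖ / ‖p.1.1 - p.1.2‖

/-- The space of displacement fields: the `C^{1,1}` maps that vanish outside the closed ball with
centre `z` and radius `r`. -/
def displacementFields {d : ℕ} (z : EuclideanSpace ℝ (Fin d)) (r : ℝ) :
    Set (EuclideanSpace ℝ (Fin d) → EuclideanSpace ℝ (Fin d)) :=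
  {φ | IsC11 φ ∧ ∀ x, x ∉ Metric.closedBall z r → φ x = 0}

/-- The deformation `Id + φ` with displacement field `φ`. -/
def deformation {d : ℕ} (φ : EuclideanSpace ℝ (Fin d) → EuclideanSpace ℝ (Fin d)) :
    EuclideanSpace ℝ (Fin d) → EuclideanSpace ℝ (Fin d) :=
  fun x => x + φ x

/-- `Id + φ` is a `C^{1,1}` diffeomorphism with inverse `Id + ψ`, where `φ` and `ψ` are
displacement fields supported in the closed ball with centre `z` and radius `r`. -/
structure IsDeformationPair {d : ℕ} (z : EuclideanSpace ℝ (Fin d)) (r : ℝ)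
    (φ ψ : EuclideanSpace ℝ (Fin d) → EuclideanSpace ℝ (Fin d)) : Prop where
  mem_left : φ ∈ displacementFields z r
  mem_right : ψ ∈ displacementFields z r
  leftInverse : Function.LeftInverse (deformation ψ) (deformation φ)
  rightInverse : Function.RightInverse (deformation ψ) (deformation φ)

/-- The size `ε = max (Lip(Dφ), Lip(Dψ))` of a deformation with displacement field `φ` whose
inverse has displacement field `ψ`. -/
noncomputable def deformationSize {d : ℕ}
    (φ ψ : EuclideanSpace ℝ (Fin d) → EuclideanSpace ℝ (Fin d)) : ℝ :=
  max (lipDeriv φ) (lipDeriv ψ)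

/-- `S` is a closed set inside the closed ball with centre `z` and radius `r > 0`, and it contains
the bounding sphere. -/
structure HasBoundingSphere {d : ℕ} (S : Set (EuclideanSpace ℝ (Fin d)))
    (z : EuclideanSpace ℝ (Fin d)) (r : ℝ) : Prop where
  isClosed : IsClosed S
  radius_pos : 0 < r
  subset_ball : S ⊆ Metric.closedBall z r
  sphere_subset : Metric.sphere z r ⊆ S

/-! Let `p` and `q` be two nearest points of `x ∈ ax(S)`, with `R = |x - p|` and unit normal `ν = (x
- p)/R`. Expanding squares, `p` is nearest to `x` iff `2R⟨ν, s - p⟩ ≤ |s - p|²` for all `s ∈ S`,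
with equality at `s = q`. Let `F = Id + φ` and transport `ν` as a conormal: `N = (D(F⁻¹)(F p))* ν`.
Then `⟨N, F s - F p⟩` differs from `⟨ν, s - p⟩` only by a Taylor remainder at most `ε|F s - F p|²`.
Hence `F p` remains nearest along its ray `F p + τN` up to some `τ₀` near `R`, while `F q` prevents
it beyond some `τ₁` near `R`.

The end of a maximal normal segment lies in the closure of the medial axis
(`mem_closure_medialAxis_of_maximal`), because off the closed axis the distance function grows at
unit rate away from the nearest point. This gives a point of the closed deformed axis within `6r²ε +
O(r³ε²)` of `x` (`exists_mem_closure_medialAxis_image_dist_le`), and `6 ≤ 1 + √50`. Applying this to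
`F⁻¹` gives the other half of the Hausdorff distance.

For (ii), apply the linear bound to `F₂ ∘ F₁⁻¹` acting on `F₁(S)`. When this map is too large for
(i), the trivial bound `2r` suffices. -/

/-! ### Nearest points, normal rays and the closure of the medial axis. -/

section MedialAxisGeometry

variable {d : ℕ} {A : Set (EuclideanSpace ℝ (Fin d))} {x y c p q N : EuclideanSpace ℝ (Fin d)}

lemma mem_closestPoints_iff_infDist :
    q ∈ closestPoints A x ↔ q ∈ A ∧ dist x q = Metric.infDist x A := by
  constructor
  · rintro ⟨hq, h⟩
    exact ⟨hq, le_antisymm ((Metric.le_infDist ⟨q, hq⟩).2 fun {s} hs => h s hs)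
      (Metric.infDist_le_dist_of_mem hq)⟩
  · rintro ⟨hq, h⟩
    exact ⟨hq, fun s hs => h ▸ Metric.infDist_le_dist_of_mem hs⟩

lemma exists_mem_closestPoints (hA : IsClosed A) (hne : A.Nonempty)
    (x : EuclideanSpace ℝ (Fin d)) : ∃ q, q ∈ closestPoints A x := by
  obtain ⟨q, hq, h⟩ := hA.exists_infDist_eq_dist hne x
  exact ⟨q, mem_closestPoints_iff_infDist.2 ⟨hq, h.symm⟩⟩

lemma mem_medialAxis_iff :
    x ∈ medialAxis A ↔ ∃ p q, p ∈ closestPoints A x ∧ q ∈ closestPoints A x ∧ p ≠ q := by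
  change 1 < (closestPoints A x).encard ↔ _
  rw [Set.one_lt_encard_iff]

lemma eq_of_notMem_medialAxis (h : x ∉ medialAxis A) (hp : p ∈ closestPoints A x)
    (hq : q ∈ closestPoints A x) : p = q := by
  by_contra hne
  exact h (mem_medialAxis_iff.2 ⟨p, q, hp, hq, hne⟩)

lemma ne_of_notMem_of_mem_closestPoints (hx : x ∉ A) (hq : q ∈ closestPoints A x) : x ≠ q :=
  fun h => hx (h ▸ hq.1)

/-- A point with a unique nearest point can be moved away from it so that the distance to the set
grows at almost unit rate. -/
lemma exists_infDist_ge_of_notMem_medialAxis (hA : IsClosed A) (hy : y ∉ medialAxis A)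
    (hq : q ∈ closestPoints A y) (hyq : y ≠ q) {η ρ : ℝ} (hη : 0 < η) (hη1 : η < 1)
    (hρ : 0 < ρ) :
    ∃ s, 0 < s ∧ s < ρ ∧
      (1 + (1 - η) * s) * ‖y - q‖ ≤ Metric.infDist (y + s • (y - q)) A := by
  have hD : 0 < ‖y - q‖ := norm_pos_iff.2 (sub_ne_zero.2 hyq)
  obtain ⟨hqA, hqd⟩ := mem_closestPoints_iff_infDist.1 hq
  rw [dist_eq_norm] at hqd
  set w := y - q with hw
  set D := ‖w‖ with hDdef
  -- `K` holds the points of `A` that would make the growth rate too small. It is closed and misses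
  -- `q`, so uniqueness of `q` keeps it at distance at least some `m > D` from `y`. For small `s`
  -- the new nearest point therefore lies outside `K`.
  let K : Set (EuclideanSpace ℝ (Fin d)) := A ∩ {a | inner ℝ w (y - a) ≤ (1 - η) * D ^ 2}
  have hK : IsClosed K := hA.inter (isClosed_le (by fun_prop) continuous_const)
  have hm : ∃ m, D < m ∧ ∀ a ∈ K, m ≤ dist y a := by
    rcases K.eq_empty_or_nonempty with h | h
    · exact ⟨D + 1, by linarith, by simp [h]⟩
    · obtain ⟨a, ha, hd⟩ := hK.exists_infDist_eq_dist h y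
      refine ⟨dist y a, lt_of_le_of_ne ?_ ?_, fun b hb => hd ▸ Metric.infDist_le_dist_of_mem hb⟩
      · exact hqd ▸ Metric.infDist_le_dist_of_mem ha.1
      · intro h
        have haq : a = q := eq_of_notMem_medialAxis hy
          (mem_closestPoints_iff_infDist.2 ⟨ha.1, by rw [← h, hqd]⟩) hq
        have := ha.2
        simp only [Set.mem_ofPred_eq, haq, ← hw, real_inner_self_eq_norm_sq] at this
        nlinarith [pow_pos hD 2]
  obtain ⟨m, hDm, hm⟩ := hm
  obtain ⟨s, hs0, hs⟩ := exists_between (show 0 < min ρ ((m - D) / (2 * D)) from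
    lt_min hρ (div_pos (by linarith) (by linarith)))
  refine ⟨s, hs0, hs.trans_le (min_le_left _ _), ?_⟩
  have hs2 : s * (2 * D) < m - D := (lt_div_iff₀ (by linarith)).1 (hs.trans_le (min_le_right _ _))
  obtain ⟨q', hq'⟩ := exists_mem_closestPoints hA ⟨q, hqA⟩ (y + s • w)
  obtain ⟨hqA', hqd'⟩ := mem_closestPoints_iff_infDist.1 hq'
  have hsw : ‖s • w‖ = s * D := by rw [norm_smul, Real.norm_of_nonneg hs0.le]
  have hq'K : q' ∉ K := by
    intro h
    have h1 := hm q' h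
    have h2 : dist y q' ≤ dist y (y + s • w) + dist (y + s • w) q' := dist_triangle _ _ _
    have h3 : dist (y + s • w) q' ≤ dist (y + s • w) y + dist y q :=
      (hq'.2 q hqA).trans (dist_triangle _ _ _)
    rw [dist_comm (y + s • w) y] at h3
    have h4 : dist y (y + s • w) = s * D := by rw [dist_self_add_right, hsw]
    have h5 : dist y q = D := by rw [dist_eq_norm]
    linarith
  have hin : (1 - η) * D ^ 2 < inner ℝ w (y - q') := by
    by_contra h
    exact hq'K ⟨hqA', not_lt.1 h⟩
  have hyq' : D ≤ ‖y - q'‖ := by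
    rw [hDdef, hw, ← dist_eq_norm, ← dist_eq_norm]
    exact hq.2 q' hqA'
  rw [← hqd', dist_eq_norm]
  refine le_of_sq_le_sq ?_ (norm_nonneg _)
  have e1 : y + s • w - q' = (y - q') + s • w := by abel
  rw [e1, norm_add_sq_real, inner_smul_right, real_inner_comm, hsw]
  have h6 : D ^ 2 ≤ ‖y - q'‖ ^ 2 := pow_le_pow_left₀ hD.le hyq' 2
  have h7 : s * ((1 - η) * D ^ 2) ≤ s * inner ℝ w (y - q') := by gcongr
  have h8 : (1 - η) ^ 2 ≤ 1 := by nlinarith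
  have h9 : (s * D) ^ 2 * (1 - η) ^ 2 ≤ (s * D) ^ 2 * 1 := by gcongr
  nlinarith

/-- If a ball around `c` misses the medial axis, then a nearest point of the centre remains nearest
when the centre is pushed away from it to the boundary of the ball. -/
lemma mem_closestPoints_add_smul (hA : IsClosed A) (hp : p ∈ closestPoints A c) (hcp : c ≠ p)
    {δ : ℝ} (hδ : 0 < δ)
    (hax : ∀ y ∈ Metric.closedBall c δ, y ∉ medialAxis A) :
    p ∈ closestPoints A (c + (δ / ‖c - p‖) • (c - p)) := by
  obtain ⟨hpA, hpd⟩ := mem_closestPoints_iff_infDist.1 hp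
  have hcont : Continuous fun y => Metric.infDist y A := Metric.continuous_infDist_pt A
  have hcpt : IsCompact (Metric.closedBall c δ) := isCompact_closedBall c δ
  have hne : (Metric.closedBall c δ).Nonempty := ⟨c, Metric.mem_closedBall_self hδ.le⟩
  -- Maximise the distance to `A` penalised by `(1 - η) * dist y c`. At an interior maximiser, a
  -- small move away from its nearest point would gain at rate `1 - η / 2` and cost at most `1 - η`,
  -- so the maximiser lies on the boundary.
  have key : ∀ η : ℝ, 0 < η → η < 1 →
      ∃ y ∈ Metric.closedBall c δ, Metric.infDist c A + (1 - η) * δ ≤ Metric.infDist y A := by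
    intro η hη hη1
    obtain ⟨y, hy, hmax⟩ := hcpt.exists_isMaxOn hne
      (f := fun y => Metric.infDist y A - (1 - η) * dist y c) (by fun_prop)
    refine ⟨y, hy, ?_⟩
    have hc := hmax (Metric.mem_closedBall_self hδ.le)
    simp only [Set.mem_ofPred_eq, dist_self, mul_zero, sub_zero] at hc
    rcases (Metric.mem_closedBall.1 hy).eq_or_lt with h | h
    · rw [h] at hc; linarith
    exfalso
    obtain ⟨q, hq⟩ := exists_mem_closestPoints hA ⟨p, hpA⟩ y
    have hqd := (mem_closestPoints_iff_infDist.1 hq).2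
    have hyq : y ≠ q := by
      rintro rfl
      rw [dist_self] at hqd
      have : 0 < dist c p := dist_pos.2 hcp
      have : 0 ≤ (1 - η) * dist y c := mul_nonneg (by linarith) dist_nonneg
      linarith
    have hD : 0 < ‖y - q‖ := norm_pos_iff.2 (sub_ne_zero.2 hyq)
    obtain ⟨s, hs0, hs1, hs⟩ := exists_infDist_ge_of_notMem_medialAxis hA (hax y hy) hq hyq
      (half_pos hη) (by linarith) (div_pos (sub_pos.2 h) hD)
    rw [lt_div_iff₀ hD] at hs1
    have hdy : dist (y + s • (y - q)) y = s * ‖y - q‖ := by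
      rw [dist_self_add_left, norm_smul, Real.norm_of_nonneg hs0.le]
    have htri := dist_triangle (y + s • (y - q)) y c
    have := hmax (Metric.mem_closedBall.2 (by linarith : dist (y + s • (y - q)) c ≤ δ))
    simp only [Set.mem_ofPred_eq] at this
    rw [dist_eq_norm] at hqd
    have h2 : (1 - η) * dist (y + s • (y - q)) c ≤ (1 - η) * (s * ‖y - q‖ + dist y c) := by
      have : 0 ≤ 1 - η := by linarith
      gcongr; linarith
    nlinarith [mul_pos hη (mul_pos hs0 hD)]
  -- The unpenalised maximum is independent of `η`; letting `η → 0` gives the full gain `δ`.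
  obtain ⟨y, hy, hmax⟩ := hcpt.exists_isMaxOn hne hcont.continuousOn
  have hylow : Metric.infDist c A + δ ≤ Metric.infDist y A := by
    refine le_of_forall_pos_lt_add fun e he => ?_
    obtain ⟨η, hη, hη'⟩ := exists_between (show 0 < min 1 (e / δ) from lt_min one_pos (by positivity))
    obtain ⟨y', hy', h⟩ := key η hη (hη'.trans_le (min_le_left _ _))
    have h1 : Metric.infDist y' A ≤ Metric.infDist y A := hmax hy'
    have h2 : η * δ < e := (lt_div_iff₀ hδ).1 (hη'.trans_le (min_le_right _ _))
    linarith
  have hD : 0 < ‖c - p‖ := norm_pos_iff.2 (sub_ne_zero.2 hcp)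
  have hyc : dist y c ≤ δ := Metric.mem_closedBall.1 hy
  have hyp := Metric.infDist_le_dist_of_mem (x := y) hpA
  have htri := dist_triangle y c p
  rw [dist_eq_norm] at hpd
  have hyc' : ‖y - c‖ = δ := by rw [← dist_eq_norm]; rw [dist_eq_norm c p] at htri; linarith
  -- Equality in the triangle inequality forces `y` onto the ray from `p` through `c`.
  have hsum : ‖(y - c) + (c - p)‖ = ‖y - c‖ + ‖c - p‖ := by
    refine le_antisymm (norm_add_le _ _) ?_
    rw [sub_add_sub_cancel, ← dist_eq_norm y p, hyc']; linarith
  have hray := (sameRay_iff_norm_add.2 hsum).norm_smul_eq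
  have hyeq : y = c + (δ / ‖c - p‖) • (c - p) := by
    rw [hyc'] at hray
    rw [div_eq_inv_mul, mul_smul, hray, smul_smul, inv_mul_cancel₀ hD.ne', one_smul]
    abel
  rw [← hyeq]
  refine mem_closestPoints_iff_infDist.2 ⟨hpA, le_antisymm ?_ hyp⟩
  rw [dist_eq_norm c p] at htri
  linarith

/-- Expanding squares makes the condition at each `a` affine in `τ`, and this is the form that can
be compared before and after a deformation. -/
lemma mem_closestPoints_add_smul_iff {τ : ℝ} :
    p ∈ closestPoints A (p + τ • N) ↔
      p ∈ A ∧ ∀ a ∈ A, 2 * τ * inner ℝ N (a - p) ≤ ‖a - p‖ ^ 2 := by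
  refine and_congr_right fun _ => forall₂_congr fun a _ => ?_
  have e1 : dist (p + τ • N) p = ‖τ • N‖ := dist_self_add_left _ _
  have e2 : dist (p + τ • N) a = ‖τ • N - (a - p)‖ := by rw [dist_eq_norm]; congr 1; abel
  rw [e1, e2, ← sq_le_sq₀ (norm_nonneg _) (norm_nonneg _), norm_sub_sq_real, inner_smul_left]
  simp only [conj_trivial]
  constructor <;> intro h <;> linarith

/-- The end of a maximal normal segment lies in the closure of the medial axis. -/
lemma mem_closure_medialAxis_of_maximal (hA : IsClosed A) {τ : ℝ} (hτ : 0 < τ) (hN : N ≠ 0)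
    (hp : p ∈ closestPoints A (p + τ • N))
    (hmax : ∀ τ' > τ, p ∉ closestPoints A (p + τ' • N)) :
    p + τ • N ∈ closure (medialAxis A) := by
  have hN' : 0 < ‖N‖ := norm_pos_iff.2 hN
  have hn : ‖p + τ • N - p‖ = τ * ‖N‖ := by
    rw [add_sub_cancel_left, norm_smul, Real.norm_of_nonneg hτ.le]
  have hpos : 0 < τ * ‖N‖ := mul_pos hτ hN'
  rw [Metric.mem_closure_iff]
  intro ε hε
  by_contra! hcon
  obtain ⟨δ, hδ, hδ'⟩ := exists_between hε
  have := mem_closestPoints_add_smul hA hp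
    (fun h => by rw [h, sub_self, norm_zero] at hn; linarith) hδ
    (fun y hy hyax => by
      have h1 := hcon y hyax
      have h2 := Metric.mem_closedBall'.1 hy
      linarith)
  rw [hn, add_sub_cancel_left, add_assoc, smul_smul, ← add_smul] at this
  exact hmax _ (by have : 0 < δ / (τ * ‖N‖) * τ := by positivity
                   linarith) this

/-- If `p` is nearest to `p + τ₀ N` but not to `p + τ N` for any `τ ≥ τ₁`, then the normal ray from
`p` meets the closure of the medial axis at some `p + τ N` with `τ₀ ≤ τ ≤ τ₁`. -/
lemma exists_mem_closure_medialAxis (hA : IsClosed A) {τ₀ τ₁ : ℝ} (hτ₀ : 0 < τ₀) (hN : N ≠ 0)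
    (hp : p ∈ closestPoints A (p + τ₀ • N))
    (hfail : ∀ τ > τ₁, p ∉ closestPoints A (p + τ • N)) :
    ∃ τ, τ₀ ≤ τ ∧ τ ≤ τ₁ ∧ p + τ • N ∈ closure (medialAxis A) := by
  let K : Set ℝ := {τ | p ∈ closestPoints A (p + τ • N)}
  have hpA : p ∈ A := hp.1
  have hK : IsClosed K := by
    have : K = ⋂ a ∈ A, {τ | 2 * τ * inner ℝ N (a - p) ≤ ‖a - p‖ ^ 2} := by
      ext τ
      simp only [K, Set.mem_ofPred_eq, mem_closestPoints_add_smul_iff, Set.mem_iInter, hpA,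
        true_and]
    rw [this]
    exact isClosed_biInter fun a _ => isClosed_le (by fun_prop) continuous_const
  have hbdd : BddAbove K := ⟨τ₁, fun τ hτ => not_lt.1 fun h => hfail τ h hτ⟩
  have hmem : sSup K ∈ K := hK.csSup_mem ⟨τ₀, hp⟩ hbdd
  have hle : τ₀ ≤ sSup K := le_csSup hbdd hp
  exact ⟨sSup K, hle, not_lt.1 fun h => hfail _ h hmem,
    mem_closure_medialAxis_of_maximal hA (hτ₀.trans_le hle) hN hmem
      fun τ' h h' => absurd (le_csSup hbdd h') (not_le.2 h)⟩

end MedialAxisGeometry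

/-! ### Consequences of the bounding sphere. -/

section BoundingSphere

variable {d : ℕ} {S : Set (EuclideanSpace ℝ (Fin d))} {x z : EuclideanSpace ℝ (Fin d)} {r : ℝ}

lemma exists_unit_vector_eq_add_smul [Nontrivial (EuclideanSpace ℝ (Fin d))]
    (z x : EuclideanSpace ℝ (Fin d)) :
    ∃ v : EuclideanSpace ℝ (Fin d), ‖v‖ = 1 ∧ x = z + ‖x - z‖ • v := by
  rcases eq_or_ne (x - z) 0 with h | h
  · obtain ⟨v, hv⟩ := exists_norm_eq (EuclideanSpace ℝ (Fin d)) zero_le_one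
    exact ⟨v, hv, by rw [h, norm_zero, zero_smul, add_zero, ← sub_eq_zero, h]⟩
  · exact ⟨‖x - z‖⁻¹ • (x - z), by simp [norm_smul, h],
      by rw [smul_smul, mul_inv_cancel₀ (norm_ne_zero_iff.2 h), one_smul]; abel⟩

lemma exists_mem_sphere_dist_eq [Nontrivial (EuclideanSpace ℝ (Fin d))] (hr : 0 ≤ r)
    (z x : EuclideanSpace ℝ (Fin d)) :
    ∃ s ∈ Metric.sphere z r, dist x s = |dist x z - r| := by
  obtain ⟨v, hv, hx⟩ := exists_unit_vector_eq_add_smul z x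
  refine ⟨z + r • v, by simp [norm_smul, hv, abs_of_nonneg hr], ?_⟩
  rw [dist_eq_norm x z]
  conv_lhs => rw [hx]
  rw [dist_add_left, dist_eq_norm, ← sub_smul, norm_smul, hv, mul_one, Real.norm_eq_abs]

/-- For `x` outside the open ball, nearest points lie both in the closed ball about `z` and in the
closed ball about `x` of radius `dist x z - r`. These balls are tangent, so by strict convexity the
midpoint of two such points would violate the triangle inequality. -/
lemma HasBoundingSphere.medialAxis_subset_ball (hS : HasBoundingSphere S z r) :
    medialAxis S ⊆ Metric.ball z r := by
  intro x hx
  obtain ⟨p, q, hp, hq, hpq⟩ := mem_medialAxis_iff.1 hx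
  have : Nontrivial (EuclideanSpace ℝ (Fin d)) := ⟨p, q, hpq⟩
  rw [Metric.mem_ball]
  by_contra! hxr
  obtain ⟨s, hs, hsd⟩ := exists_mem_sphere_dist_eq hS.radius_pos.le z x
  rw [abs_of_nonneg (sub_nonneg.2 hxr)] at hsd
  have hp' : p ∈ Metric.closedBall x (dist x z - r) :=
    Metric.mem_closedBall'.2 (hsd ▸ hp.2 s (hS.sphere_subset hs))
  have hq' : q ∈ Metric.closedBall x (dist x z - r) :=
    Metric.mem_closedBall'.2 (hsd ▸ hq.2 s (hS.sphere_subset hs))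
  have h1 : dist x ((1 / 2 : ℝ) • p + (1 / 2 : ℝ) • q) < dist x z - r := Metric.mem_ball'.1 (combo_mem_ball_of_ne hp' hq' hpq (a := 1 / 2) (b := 1 / 2)
    (by norm_num) (by norm_num) (by norm_num))
  have h2 : dist ((1 / 2 : ℝ) • p + (1 / 2 : ℝ) • q) z ≤ r := Metric.mem_closedBall.1 ((convex_closedBall z r) (hS.subset_ball hp.1)
    (hS.subset_ball hq.1) (a := 1 / 2) (b := 1 / 2) (by norm_num) (by norm_num) (by norm_num))
  have h3 := dist_triangle x ((1 / 2 : ℝ) • p + (1 / 2 : ℝ) • q) z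
  linarith

lemma HasBoundingSphere.dist_le_of_mem_medialAxis (hS : HasBoundingSphere S z r)
    (hx : x ∈ medialAxis S) {p : EuclideanSpace ℝ (Fin d)} (hp : p ∈ closestPoints S x) :
    dist x p ≤ r := by
  obtain ⟨p', q', _, _, hpq⟩ := mem_medialAxis_iff.1 hx
  have : Nontrivial (EuclideanSpace ℝ (Fin d)) := ⟨p', q', hpq⟩
  obtain ⟨s, hs, hsd⟩ := exists_mem_sphere_dist_eq hS.radius_pos.le z x
  have h1 := hp.2 s (hS.sphere_subset hs)
  have h2 := Metric.mem_ball.1 (hS.medialAxis_subset_ball hx)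
  rw [hsd, abs_of_neg (by linarith)] at h1
  linarith [dist_nonneg (x := x) (y := z)]

/-- The medial axis is nonempty exactly when the set is nonempty and misses a point of the ball. -/
lemma HasBoundingSphere.medialAxis_nonempty_iff (hS : HasBoundingSphere S z r) :
    (medialAxis S).Nonempty ↔ S.Nonempty ∧ ∃ y ∈ Metric.closedBall z r, y ∉ S := by
  constructor
  · rintro ⟨x, hx⟩
    obtain ⟨p, q, hp, hq, hpq⟩ := mem_medialAxis_iff.1 hx
    refine ⟨⟨p, hp.1⟩, x, Metric.ball_subset_closedBall (hS.medialAxis_subset_ball hx), ?_⟩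
    intro hxS
    have h1 := dist_le_zero.1 ((hp.2 x hxS).trans (dist_self x).le)
    have h2 := dist_le_zero.1 ((hq.2 x hxS).trans (dist_self x).le)
    exact hpq (h1.symm.trans h2)
  · rintro ⟨hne, y, hy, hyS⟩
    -- A point of the ball farthest from `S` is off the sphere, and must lie on the axis: otherwise
    -- a small move away from its unique nearest point would increase the distance.
    obtain ⟨c, hc, hmax⟩ := (isCompact_closedBall z r).exists_isMaxOn ⟨y, hy⟩
      (Metric.continuous_infDist_pt S).continuousOn
    have hy0 : 0 < Metric.infDist y S := (hS.isClosed.notMem_iff_infDist_pos hne).1 hyS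
    have hc0 : c ∉ S := (hS.isClosed.notMem_iff_infDist_pos hne).2 (hy0.trans_le (hmax hy))
    refine ⟨c, ?_⟩
    by_contra hax
    have hcr : dist c z < r := lt_of_le_of_ne (Metric.mem_closedBall.1 hc)
      fun h => hc0 (hS.sphere_subset (Metric.mem_sphere.2 h))
    obtain ⟨q, hq⟩ := exists_mem_closestPoints hS.isClosed hne c
    have hcq := ne_of_notMem_of_mem_closestPoints hc0 hq
    have hD : 0 < ‖c - q‖ := norm_pos_iff.2 (sub_ne_zero.2 hcq)
    obtain ⟨s, hs0, hs1, hs⟩ := exists_infDist_ge_of_notMem_medialAxis hS.isClosed hax hq hcq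
      one_half_pos one_half_lt_one (div_pos (sub_pos.2 hcr) hD)
    rw [lt_div_iff₀ hD] at hs1
    have hdc : dist (c + s • (c - q)) c = s * ‖c - q‖ := by
      rw [dist_self_add_left, norm_smul, Real.norm_of_nonneg hs0.le]
    have htri := dist_triangle (c + s • (c - q)) c z
    have h1 : Metric.infDist (c + s • (c - q)) S ≤ Metric.infDist c S :=
      hmax (Metric.mem_closedBall.2 (by linarith))
    have h2 := (mem_closestPoints_iff_infDist.1 hq).2
    rw [dist_eq_norm] at h2
    nlinarith [mul_pos hs0 hD]

end BoundingSphere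

/-! ### Bounds for displacement fields in terms of `Lip(Dφ)`. -/

section DisplacementFields

variable {d : ℕ} {φ ψ : EuclideanSpace ℝ (Fin d) → EuclideanSpace ℝ (Fin d)}
  {z : EuclideanSpace ℝ (Fin d)} {r : ℝ}

lemma lipDeriv_nonneg (φ : EuclideanSpace ℝ (Fin d) → EuclideanSpace ℝ (Fin d)) :
    0 ≤ lipDeriv φ :=
  Real.iSup_nonneg fun _ => by positivity

lemma lipDeriv_le {K : ℝ} (hK : 0 ≤ K)
    (h : ∀ x y, ‖fderiv ℝ φ x - fderiv ℝ φ y‖ ≤ K * ‖x - y‖) : lipDeriv φ ≤ K :=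
  Real.iSup_le (fun _ => div_le_of_le_mul₀ (norm_nonneg _) hK (h _ _)) hK

lemma IsC11.norm_fderiv_sub_le (hφ : IsC11 φ) (x y : EuclideanSpace ℝ (Fin d)) :
    ‖fderiv ℝ φ x - fderiv ℝ φ y‖ ≤ lipDeriv φ * ‖x - y‖ := by
  rcases eq_or_ne x y with rfl | hxy
  · simp
  obtain ⟨-, K, hK⟩ := hφ
  have hpos : 0 < ‖x - y‖ := norm_pos_iff.2 (sub_ne_zero.2 hxy)
  rw [← div_le_iff₀ hpos]
  refine le_ciSup (f := fun p : {u : EuclideanSpace ℝ (Fin d) × EuclideanSpace ℝ (Fin d) //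
    u.1 ≠ u.2} => ‖fderiv ℝ φ p.1.1 - fderiv ℝ φ p.1.2‖ / ‖p.1.1 - p.1.2‖) ?_ ⟨(x, y), hxy⟩
  refine ⟨K, ?_⟩
  rintro _ ⟨p, rfl⟩
  exact div_le_of_le_mul₀ (norm_nonneg _) K.2 (hK.norm_sub_le _ _)

lemma IsC11.differentiable (hφ : IsC11 φ) : Differentiable ℝ φ :=
  hφ.1.differentiable one_ne_zero

/-- Mean value inequality for `φ - Dφ(x)` on the ball of radius `|y - x|` about `x`. The sharper
Taylor factor `1/2` is not needed. -/
lemma IsC11.norm_sub_sub_fderiv_le (hφ : IsC11 φ) (x y : EuclideanSpace ℝ (Fin d)) :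
    ‖φ y - φ x - fderiv ℝ φ x (y - x)‖ ≤ lipDeriv φ * ‖y - x‖ ^ 2 := by
  have h := (convex_closedBall x ‖y - x‖).norm_image_sub_le_of_norm_fderiv_le' (𝕜 := ℝ) (f := φ)
    (φ := fderiv ℝ φ x) (C := lipDeriv φ * ‖y - x‖) (x := x) (y := y)
    (fun u _ => hφ.differentiable u)
    (fun u hu => (hφ.norm_fderiv_sub_le u x).trans (mul_le_mul_of_nonneg_left
      (by simpa [dist_eq_norm] using hu) (lipDeriv_nonneg φ)))
    (Metric.mem_closedBall_self (norm_nonneg _)) (by simp [dist_eq_norm])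
  rwa [mul_assoc, ← sq] at h

lemma IsC11.sub (hφ : IsC11 φ) (hψ : IsC11 ψ) : IsC11 (φ - ψ) := by
  refine ⟨hφ.1.sub hψ.1, ?_⟩
  obtain ⟨K, hK⟩ := hφ.2
  obtain ⟨L, hL⟩ := hψ.2
  refine ⟨K + L, ?_⟩
  have : fderiv ℝ (φ - ψ) = fun x => fderiv ℝ φ x - fderiv ℝ ψ x :=
    funext fun x => fderiv_sub (hφ.differentiable x) (hψ.differentiable x)
  rw [this]
  exact hK.sub hL

lemma mem_displacementFields_sub (hφ : φ ∈ displacementFields z r)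
    (hψ : ψ ∈ displacementFields z r) : φ - ψ ∈ displacementFields z r :=
  ⟨hφ.1.sub hψ.1, fun x hx => by simp [hφ.2 x hx, hψ.2 x hx]⟩

lemma eq_zero_of_continuous_of_notMem_ball {F : Type*} [TopologicalSpace F] [T2Space F] [Zero F]
    {f : EuclideanSpace ℝ (Fin d) → F} (hr : 0 < r) (hf : Continuous f)
    (h : ∀ x, x ∉ Metric.closedBall z r → f x = 0) {x : EuclideanSpace ℝ (Fin d)}
    (hx : x ∉ Metric.ball z r) : f x = 0 := by
  have hcl : IsClosed {x | f x = 0} := isClosed_eq hf continuous_const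
  refine (hcl.closure_subset_iff (s := (Metric.closedBall z r)ᶜ)).2 h ?_
  rwa [closure_compl, interior_closedBall z hr.ne']

lemma eq_zero_of_mem_displacementFields (hr : 0 < r) (hφ : φ ∈ displacementFields z r)
    {x : EuclideanSpace ℝ (Fin d)} (hx : x ∉ Metric.ball z r) : φ x = 0 :=
  eq_zero_of_continuous_of_notMem_ball hr hφ.1.1.continuous hφ.2 hx

lemma fderiv_eq_zero_of_mem_displacementFields (hr : 0 < r) (hφ : φ ∈ displacementFields z r)
    {x : EuclideanSpace ℝ (Fin d)} (hx : x ∉ Metric.ball z r) : fderiv ℝ φ x = 0 := by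
  refine eq_zero_of_continuous_of_notMem_ball hr (hφ.1.1.continuous_fderiv one_ne_zero) ?_ hx
  intro y hy
  have : φ =ᶠ[nhds y] fun _ => 0 := by
    filter_upwards [Metric.isClosed_closedBall.isOpen_compl.mem_nhds hy] with u hu
    exact hφ.2 u hu
  rw [this.fderiv_eq, fderiv_fun_const]
  rfl

lemma exists_notMem_ball_norm_sub_le [Nontrivial (EuclideanSpace ℝ (Fin d))] (hr : 0 < r)
    (z x : EuclideanSpace ℝ (Fin d)) : ∃ s, s ∉ Metric.ball z r ∧ ‖x - s‖ ≤ r := by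
  by_cases hx : x ∈ Metric.ball z r
  · obtain ⟨s, hs, hsd⟩ := exists_mem_sphere_dist_eq hr.le z x
    refine ⟨s, by simp [Metric.mem_sphere.1 hs], ?_⟩
    rw [← dist_eq_norm, hsd, abs_of_neg (sub_neg.2 (Metric.mem_ball.1 hx))]
    linarith [dist_nonneg (x := x) (y := z)]
  · exact ⟨x, hx, by simpa using hr.le⟩

/-- In positive dimension every point is within `r` of the complement of the open ball, where `Dφ`
vanishes. In dimension `0` there is no such complement, but everything is zero. -/
lemma norm_fderiv_le_of_mem_displacementFields (hr : 0 < r) (hφ : φ ∈ displacementFields z r)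
    (x : EuclideanSpace ℝ (Fin d)) : ‖fderiv ℝ φ x‖ ≤ r * lipDeriv φ := by
  rcases subsingleton_or_nontrivial (EuclideanSpace ℝ (Fin d)) with h | h
  · rw [Subsingleton.elim (fderiv ℝ φ x) 0, norm_zero]
    exact mul_nonneg hr.le (lipDeriv_nonneg φ)
  · obtain ⟨s, hs, hsd⟩ := exists_notMem_ball_norm_sub_le hr z x
    have h1 := hφ.1.norm_fderiv_sub_le x s
    rw [fderiv_eq_zero_of_mem_displacementFields hr hφ hs, sub_zero] at h1
    rw [mul_comm]
    exact h1.trans (mul_le_mul_of_nonneg_left hsd (lipDeriv_nonneg φ))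

lemma norm_sub_le_of_mem_displacementFields (hr : 0 < r) (hφ : φ ∈ displacementFields z r)
    (x y : EuclideanSpace ℝ (Fin d)) : ‖φ x - φ y‖ ≤ r * lipDeriv φ * ‖x - y‖ :=
  convex_univ.norm_image_sub_le_of_norm_fderiv_le (𝕜 := ℝ)
    (fun u _ => hφ.1.differentiable u)
    (fun u _ => norm_fderiv_le_of_mem_displacementFields hr hφ u) (Set.mem_univ y) (Set.mem_univ x)

lemma norm_le_of_mem_displacementFields (hr : 0 < r) (hφ : φ ∈ displacementFields z r)
    (x : EuclideanSpace ℝ (Fin d)) : ‖φ x‖ ≤ r * lipDeriv φ * r := by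
  have h0 : 0 ≤ r * lipDeriv φ := mul_nonneg hr.le (lipDeriv_nonneg φ)
  rcases subsingleton_or_nontrivial (EuclideanSpace ℝ (Fin d)) with h | h
  · rw [Subsingleton.elim (φ x) 0, norm_zero]
    exact mul_nonneg h0 hr.le
  · obtain ⟨s, hs, hsd⟩ := exists_notMem_ball_norm_sub_le hr z x
    have h1 := norm_sub_le_of_mem_displacementFields hr hφ x s
    rw [eq_zero_of_mem_displacementFields hr hφ hs, sub_zero] at h1
    exact h1.trans (mul_le_mul_of_nonneg_left hsd h0)

lemma norm_deformation_sub_le (hr : 0 < r) (hφ : φ ∈ displacementFields z r)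
    (x y : EuclideanSpace ℝ (Fin d)) :
    ‖deformation φ x - deformation φ y‖ ≤ (1 + r * lipDeriv φ) * ‖x - y‖ := by
  have e : deformation φ x - deformation φ y = (x - y) + (φ x - φ y) := by
    simp only [deformation]; abel
  rw [e]
  linarith [norm_add_le (x - y) (φ x - φ y), norm_sub_le_of_mem_displacementFields hr hφ x y]

lemma hasFDerivAt_deformation (hφ : φ ∈ displacementFields z r) (x : EuclideanSpace ℝ (Fin d)) :
    HasFDerivAt (deformation φ)
      (ContinuousLinearMap.id ℝ (EuclideanSpace ℝ (Fin d)) + fderiv ℝ φ x) x :=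
  (hasFDerivAt_id x).add (hφ.1.differentiable x).hasFDerivAt

lemma contDiff_deformation (hφ : φ ∈ displacementFields z r) : ContDiff ℝ 1 (deformation φ) :=
  contDiff_id.add hφ.1.1

lemma lipDeriv_sub_comm (φ ψ : EuclideanSpace ℝ (Fin d) → EuclideanSpace ℝ (Fin d)) :
    lipDeriv (φ - ψ) = lipDeriv (ψ - φ) := by
  have h : ∀ x, fderiv ℝ (φ - ψ) x = -fderiv ℝ (ψ - φ) x := fun x => by
    rw [← neg_sub ψ φ, fderiv_neg]
  refine iSup_congr fun p => ?_
  rw [h, h, neg_sub_neg, norm_sub_rev]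

/-- By the chain rule the difference splits in two. Varying `Dη` costs `(1 + M)²`; varying `Dψ`
costs `M`, since `‖Dη‖ ≤ r * lipDeriv η`. -/
lemma norm_fderiv_comp_deformation_sub_le {η : EuclideanSpace ℝ (Fin d) → EuclideanSpace ℝ (Fin d)}
    {M : ℝ} (hr : 0 < r) (hη : η ∈ displacementFields z r) (hψ : ψ ∈ displacementFields z r)
    (hM : r * lipDeriv ψ ≤ M) (x y : EuclideanSpace ℝ (Fin d)) :
    ‖fderiv ℝ (η ∘ deformation ψ) x - fderiv ℝ (η ∘ deformation ψ) y‖ ≤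
      ((1 + M) ^ 2 + M) * lipDeriv η * ‖x - y‖ := by
  have hlη := lipDeriv_nonneg η
  have hM0 : 0 ≤ M := (mul_nonneg hr.le (lipDeriv_nonneg ψ)).trans hM
  have hd : ∀ u, fderiv ℝ (η ∘ deformation ψ) u = (fderiv ℝ η (deformation ψ u)).comp
      (ContinuousLinearMap.id ℝ (EuclideanSpace ℝ (Fin d)) + fderiv ℝ ψ u) := fun u =>
    ((hη.1.differentiable _).hasFDerivAt.comp u (hasFDerivAt_deformation hψ u)).fderiv
  have hnorm : ‖ContinuousLinearMap.id ℝ (EuclideanSpace ℝ (Fin d)) + fderiv ℝ ψ x‖ ≤ 1 + M :=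
    (norm_add_le _ _).trans (add_le_add ContinuousLinearMap.norm_id_le
      ((norm_fderiv_le_of_mem_displacementFields hr hψ x).trans hM))
  have e : fderiv ℝ (η ∘ deformation ψ) x - fderiv ℝ (η ∘ deformation ψ) y =
      (fderiv ℝ η (deformation ψ x) - fderiv ℝ η (deformation ψ y)).comp
        (ContinuousLinearMap.id ℝ (EuclideanSpace ℝ (Fin d)) + fderiv ℝ ψ x) +
      (fderiv ℝ η (deformation ψ y)).comp (fderiv ℝ ψ x - fderiv ℝ ψ y) := by
    rw [hd, hd]; ext u : 1; simp; abel
  have h1 : ‖fderiv ℝ η (deformation ψ x) - fderiv ℝ η (deformation ψ y)‖ ≤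
      lipDeriv η * ((1 + M) * ‖x - y‖) :=
    (hη.1.norm_fderiv_sub_le _ _).trans (mul_le_mul_of_nonneg_left
      ((norm_deformation_sub_le hr hψ x y).trans (by gcongr)) hlη)
  have h2 : ‖fderiv ℝ η (deformation ψ y)‖ * ‖fderiv ℝ ψ x - fderiv ℝ ψ y‖ ≤
      (r * lipDeriv η) * (lipDeriv ψ * ‖x - y‖) :=
    mul_le_mul (norm_fderiv_le_of_mem_displacementFields hr hη _) (hψ.1.norm_fderiv_sub_le x y)
      (norm_nonneg _) (mul_nonneg hr.le hlη)
  have h3 : (r * lipDeriv ψ) * (lipDeriv η * ‖x - y‖) ≤ M * (lipDeriv η * ‖x - y‖) := by gcongr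
  rw [e]
  calc _ ≤ _ := norm_add_le _ _
    _ ≤ (lipDeriv η * ((1 + M) * ‖x - y‖)) * (1 + M) +
        ‖fderiv ℝ η (deformation ψ y)‖ * ‖fderiv ℝ ψ x - fderiv ℝ ψ y‖ :=
      add_le_add ((ContinuousLinearMap.opNorm_comp_le _ _).trans (by gcongr))
        (ContinuousLinearMap.opNorm_comp_le _ _)
    _ ≤ _ := by linarith

lemma comp_deformation_mem_displacementFields
    {η : EuclideanSpace ℝ (Fin d) → EuclideanSpace ℝ (Fin d)} (hr : 0 < r)
    (hη : η ∈ displacementFields z r) (hψ : ψ ∈ displacementFields z r) :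
    η ∘ deformation ψ ∈ displacementFields z r := by
  refine ⟨⟨hη.1.1.comp (contDiff_deformation hψ),
    Real.toNNReal (((1 + r * lipDeriv ψ) ^ 2 + r * lipDeriv ψ) * lipDeriv η), ?_⟩, ?_⟩
  · refine LipschitzWith.of_dist_le_mul fun x y => ?_
    rw [dist_eq_norm, dist_eq_norm]
    exact (norm_fderiv_comp_deformation_sub_le hr hη hψ le_rfl x y).trans
      (mul_le_mul_of_nonneg_right (Real.le_coe_toNNReal _) (norm_nonneg _))
  · intro x hx
    rw [Function.comp_apply, deformation, hψ.2 x hx, add_zero, hη.2 x hx]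

lemma lipDeriv_comp_deformation_le
    {η : EuclideanSpace ℝ (Fin d) → EuclideanSpace ℝ (Fin d)} {M : ℝ} (hr : 0 < r)
    (hη : η ∈ displacementFields z r) (hψ : ψ ∈ displacementFields z r)
    (hM : r * lipDeriv ψ ≤ M) :
    lipDeriv (η ∘ deformation ψ) ≤ ((1 + M) ^ 2 + M) * lipDeriv η := by
  have hM0 : 0 ≤ M := (mul_nonneg hr.le (lipDeriv_nonneg ψ)).trans hM
  exact lipDeriv_le (mul_nonneg (by positivity) (lipDeriv_nonneg η))
    (norm_fderiv_comp_deformation_sub_le hr hη hψ hM)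

end DisplacementFields

/-! ### Inverses and compositions of deformations. -/

section DeformationPairs

variable {d : ℕ} {S : Set (EuclideanSpace ℝ (Fin d))} {z : EuclideanSpace ℝ (Fin d)} {r : ℝ}
  {φ ψ φ₁ ψ₁ φ₂ ψ₂ : EuclideanSpace ℝ (Fin d) → EuclideanSpace ℝ (Fin d)}

lemma IsDeformationPair.symm (h : IsDeformationPair z r φ ψ) : IsDeformationPair z r ψ φ :=
  ⟨h.mem_right, h.mem_left, h.rightInverse, h.leftInverse⟩

lemma deformationSize_comm (φ ψ : EuclideanSpace ℝ (Fin d) → EuclideanSpace ℝ (Fin d)) :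
    deformationSize φ ψ = deformationSize ψ φ :=
  max_comm _ _

lemma deformationSize_nonneg (φ ψ : EuclideanSpace ℝ (Fin d) → EuclideanSpace ℝ (Fin d)) :
    0 ≤ deformationSize φ ψ :=
  (lipDeriv_nonneg φ).trans (le_max_left _ _)

lemma IsDeformationPair.image_image (h : IsDeformationPair z r φ ψ) (S) :
    deformation ψ '' (deformation φ '' S) = S :=
  h.leftInverse.image_image S

/-- A point sent outside the ball would be fixed by the inverse, hence already outside. -/
lemma IsDeformationPair.deformation_mem_closedBall (h : IsDeformationPair z r φ ψ)
    {x : EuclideanSpace ℝ (Fin d)} (hx : x ∈ Metric.closedBall z r) :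
    deformation φ x ∈ Metric.closedBall z r := by
  by_contra hFx
  have h1 := h.leftInverse x
  rw [deformation, h.mem_right.2 _ hFx, add_zero] at h1
  exact hFx (h1.symm ▸ hx)

lemma HasBoundingSphere.image (hS : HasBoundingSphere S z r) (h : IsDeformationPair z r φ ψ) :
    HasBoundingSphere (deformation φ '' S) z r where
  isClosed := by
    rw [Set.image_eq_preimage_of_inverse h.leftInverse h.rightInverse]
    exact hS.isClosed.preimage (contDiff_deformation h.mem_right).continuous
  radius_pos := hS.radius_pos
  subset_ball := by
    rintro _ ⟨x, hx, rfl⟩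
    exact h.deformation_mem_closedBall (hS.subset_ball hx)
  sphere_subset := fun x hx => ⟨x, hS.sphere_subset hx, by
    rw [deformation, eq_zero_of_mem_displacementFields hS.radius_pos h.mem_left
      (by simp [Metric.mem_sphere.1 hx]), add_zero]⟩

lemma IsDeformationPair.medialAxis_image_nonempty_iff (hS : HasBoundingSphere S z r)
    (h : IsDeformationPair z r φ ψ) :
    (medialAxis (deformation φ '' S)).Nonempty ↔ (medialAxis S).Nonempty := by
  rw [(hS.image h).medialAxis_nonempty_iff, hS.medialAxis_nonempty_iff, Set.image_nonempty]
  refine and_congr_right fun _ => ⟨?_, ?_⟩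
  · rintro ⟨y, hy, hyS⟩
    exact ⟨deformation ψ y, h.symm.deformation_mem_closedBall hy,
      fun hS' => hyS ⟨_, hS', h.rightInverse y⟩⟩
  · rintro ⟨y, hy, hyS⟩
    exact ⟨deformation φ y, h.deformation_mem_closedBall hy,
      fun hS' => hyS ((h.leftInverse.injective.mem_set_image).1 hS')⟩

lemma IsDeformationPair.deformation_comp (h₁ : IsDeformationPair z r φ₁ ψ₁) :
    deformation ((φ₂ - φ₁) ∘ deformation ψ₁) = deformation φ₂ ∘ deformation ψ₁ := by
  funext x
  have h := h₁.rightInverse x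
  simp only [deformation, Function.comp_apply, Pi.sub_apply] at h ⊢
  nth_rewrite 1 [← h]
  abel

/-- This pair is `F₂ ∘ F₁⁻¹` and its inverse; both displacements involve only the difference of `φ₁`
and `φ₂`, which makes the estimate in (ii) Lipschitz. -/
lemma IsDeformationPair.comp (hr : 0 < r) (h₁ : IsDeformationPair z r φ₁ ψ₁)
    (h₂ : IsDeformationPair z r φ₂ ψ₂) :
    IsDeformationPair z r ((φ₂ - φ₁) ∘ deformation ψ₁) ((φ₁ - φ₂) ∘ deformation ψ₂) where
  mem_left := comp_deformation_mem_displacementFields hr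
    (mem_displacementFields_sub h₂.mem_left h₁.mem_left) h₁.mem_right
  mem_right := comp_deformation_mem_displacementFields hr
    (mem_displacementFields_sub h₁.mem_left h₂.mem_left) h₂.mem_right
  leftInverse := by
    rw [h₁.deformation_comp, h₂.deformation_comp]
    exact h₁.rightInverse.comp h₂.leftInverse
  rightInverse := by
    rw [h₁.deformation_comp, h₂.deformation_comp]
    exact h₂.rightInverse.comp h₁.leftInverse

lemma IsDeformationPair.comp_image (h₁ : IsDeformationPair z r φ₁ ψ₁)
    (φ₂ : EuclideanSpace ℝ (Fin d) → EuclideanSpace ℝ (Fin d)) (S) :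
    deformation ((φ₂ - φ₁) ∘ deformation ψ₁) '' (deformation φ₁ '' S) = deformation φ₂ '' S := by
  rw [h₁.deformation_comp, Set.image_comp, h₁.image_image]

lemma IsDeformationPair.deformationSize_comp_le {M : ℝ} (hr : 0 < r)
    (h₁ : IsDeformationPair z r φ₁ ψ₁) (h₂ : IsDeformationPair z r φ₂ ψ₂)
    (hM₁ : r * deformationSize φ₁ ψ₁ ≤ M) (hM₂ : r * deformationSize φ₂ ψ₂ ≤ M) :
    deformationSize ((φ₂ - φ₁) ∘ deformation ψ₁) ((φ₁ - φ₂) ∘ deformation ψ₂) ≤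
      ((1 + M) ^ 2 + M) * lipDeriv (φ₁ - φ₂) := by
  refine max_le ?_ ?_
  · rw [lipDeriv_sub_comm φ₁ φ₂]
    exact lipDeriv_comp_deformation_le hr (mem_displacementFields_sub h₂.mem_left h₁.mem_left)
      h₁.mem_right ((mul_le_mul_of_nonneg_left (le_max_right _ _) hr.le).trans hM₁)
  · exact lipDeriv_comp_deformation_le hr (mem_displacementFields_sub h₁.mem_left h₂.mem_left)
      h₂.mem_right ((mul_le_mul_of_nonneg_left (le_max_right _ _) hr.le).trans hM₂)

end DeformationPairs

/-! ### Stability of the medial axis. -/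

section Stability

variable {d : ℕ} {S : Set (EuclideanSpace ℝ (Fin d))} {z : EuclideanSpace ℝ (Fin d)} {r : ℝ}
  {φ ψ φ₁ ψ₁ φ₂ ψ₂ : EuclideanSpace ℝ (Fin d) → EuclideanSpace ℝ (Fin d)}

lemma one_eighth_le_contact_factor {e : ℝ} (he0 : 0 ≤ e) (he : e ≤ 1 / 4) :
    1 - 4 * e + 2 * e ^ 2 ≤ 1 / (1 + e) ^ 2 - 2 * e ∧ 1 / 8 ≤ 1 / (1 + e) ^ 2 - 2 * e := by
  have h1 : 1 - 2 * e + 2 * e ^ 2 ≤ 1 / (1 + e) ^ 2 := by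
    rw [le_div_iff₀ (by positivity)]
    have : (1 - 2 * e + 2 * e ^ 2) * (1 + e) ^ 2 = 1 - e ^ 2 * (1 - 2 * e - 2 * e ^ 2) := by ring
    rw [this]
    have : 0 ≤ e ^ 2 * (1 - 2 * e - 2 * e ^ 2) := mul_nonneg (sq_nonneg e) (by nlinarith)
    linarith
  exact ⟨by linarith, by nlinarith⟩

lemma abs_sub_le_of_contact_bounds {e R τ : ℝ} (he0 : 0 ≤ e) (he : e ≤ 1 / 4) (hR : 0 ≤ R)
    (h₀ : R / ((1 + e) ^ 2 + 2 * e) ≤ τ) (h₁ : τ ≤ R / (1 / (1 + e) ^ 2 - 2 * e)) :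
    |R - τ| ≤ R * (4 * e + 128 * e ^ 2) := by
  obtain ⟨hk1, hk2⟩ := one_eighth_le_contact_factor he0 he
  set k := 1 / (1 + e) ^ 2 - 2 * e
  rw [div_le_iff₀ (by positivity)] at h₀
  rw [le_div_iff₀ (by linarith)] at h₁
  rw [abs_le]
  -- With `1 - 4e + 2e²` in place of `k` the product is `1 + e²(114 - 504e + 256e²)`, which is at
  -- least `1` for `e ≤ 1/4`; hence the coefficient `128`.
  have hinv : 1 ≤ k * (1 + 4 * e + 128 * e ^ 2) := by
    have : (1 - 4 * e + 2 * e ^ 2) * (1 + 4 * e + 128 * e ^ 2) ≤ k * (1 + 4 * e + 128 * e ^ 2) := by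
      gcongr
    rcases le_total e (1 / 5) with h | h
    · nlinarith [mul_nonneg (sq_nonneg e) (show 0 ≤ 1 / 5 - e by linarith), pow_nonneg he0 4]
    · nlinarith [mul_le_mul_of_nonneg_right hk2
        (show 0 ≤ 1 + 4 * e + 128 * e ^ 2 by positivity)]
  constructor
  · have h3 : τ * k ≤ R * (1 + 4 * e + 128 * e ^ 2) * k := by nlinarith
    have := le_of_mul_le_mul_right h3 (by linarith)
    linarith
  · have h3 : R * (1 - (4 * e + 128 * e ^ 2)) * ((1 + e) ^ 2 + 2 * e) ≤
        τ * ((1 + e) ^ 2 + 2 * e) := by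
      refine le_trans ?_ h₀
      have : (1 - (4 * e + 128 * e ^ 2)) * ((1 + e) ^ 2 + 2 * e) ≤ 1 := by
        nlinarith [pow_nonneg he0 2, pow_nonneg he0 3, pow_nonneg he0 4]
      nlinarith
    have := le_of_mul_le_mul_right h3 (by positivity)
    linarith

/-- A point `x` of the medial axis with nearest point `p` is close to a point of the closed medial
axis of the deformed set, found on the normal ray of the deformed set at the image of `p`. -/
lemma exists_mem_closure_medialAxis_image_dist_le (hS : HasBoundingSphere S z r)
    (h : IsDeformationPair z r φ ψ) (he : r * deformationSize φ ψ ≤ 1 / 4)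
    {x : EuclideanSpace ℝ (Fin d)} (hx : x ∈ medialAxis S) :
    ∃ y ∈ closure (medialAxis (deformation φ '' S)),
      dist x y ≤ r * (6 * (r * deformationSize φ ψ) + 200 * (r * deformationSize φ ψ) ^ 2) := by
  have hr := hS.radius_pos
  obtain ⟨p, q, hp, hq, hpq⟩ := mem_medialAxis_iff.1 hx
  have hRr : dist x p ≤ r := hS.dist_le_of_mem_medialAxis hx hp
  have hxq : dist x q = dist x p := le_antisymm (hq.2 p hp.1) (hp.2 q hq.1)
  have hR : 0 < dist x p := by
    refine dist_pos.2 fun hxp => hpq ?_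
    rw [hxp, dist_self] at hxq
    exact dist_eq_zero.1 hxq
  set R := dist x p with hRdef
  set ε := deformationSize φ ψ with hε
  set e := r * ε with hedef
  have hε0 : 0 ≤ ε := deformationSize_nonneg φ ψ
  have he0 : 0 ≤ e := mul_nonneg hr.le hε0
  have hφe : r * lipDeriv φ ≤ e := mul_le_mul_of_nonneg_left (le_max_left _ _) hr.le
  have hψe : r * lipDeriv ψ ≤ e := mul_le_mul_of_nonneg_left (le_max_right _ _) hr.le
  set F := deformation φ with hF
  set D := fderiv ℝ ψ (F p) with hD
  set ν : EuclideanSpace ℝ (Fin d) := R⁻¹ • (x - p) with hν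
  have hν1 : ‖ν‖ = 1 := by
    rw [hν, norm_smul, ← dist_eq_norm, ← hRdef, norm_inv, Real.norm_of_nonneg hR.le,
      inv_mul_cancel₀ hR.ne']
  have hxν : x = p + R • ν := by
    rw [hν, smul_smul, mul_inv_cancel₀ hR.ne', one_smul]; abel
  -- The adjoint of `D(F⁻¹)` at `F p` applied to `ν`: the conormal transport, not renormalised.
  set N := ν + ContinuousLinearMap.adjoint D ν with hN
  have hNν : ‖N - ν‖ ≤ e := by
    rw [hN, add_sub_cancel_left]
    refine (ContinuousLinearMap.le_opNorm _ _).trans ?_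
    rw [hν1, mul_one, LinearIsometryEquiv.norm_map]
    exact (norm_fderiv_le_of_mem_displacementFields hr h.mem_right _).trans hψe
  have hNle : ‖N‖ ≤ 1 + e := by
    have := norm_add_le ν (N - ν)
    rw [add_sub_cancel] at this
    linarith
  have hN0 : N ≠ 0 := by
    intro h0
    rw [h0, zero_sub, norm_neg, hν1] at hNν
    linarith
  -- comparison of the normal components before and after the deformation
  have hcomp : ∀ s, |inner ℝ N (F s - F p) - inner ℝ ν (s - p)| ≤ ε * ‖F s - F p‖ ^ 2 := by
    intro s
    have hs : s - p = (F s - F p) + (ψ (F s) - ψ (F p)) := by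
      have h1 := h.leftInverse s
      have h2 := h.leftInverse p
      simp only [← hF] at h1 h2
      rw [deformation] at h1 h2
      nth_rewrite 1 [← h1, ← h2]
      abel
    -- The adjoint term cancels the linear part of `ψ`, leaving only its first-order Taylor
    -- remainder.
    have h3 : inner ℝ N (F s - F p) - inner ℝ ν (s - p) =
        -inner ℝ ν (ψ (F s) - ψ (F p) - D (F s - F p)) := by
      rw [hs, hN, inner_add_left, ContinuousLinearMap.adjoint_inner_left, inner_add_right,
        inner_sub_right ν (ψ (F s) - ψ (F p)) (D (F s - F p))]
      ring
    rw [h3, abs_neg]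
    refine (abs_real_inner_le_norm _ _).trans ?_
    rw [hν1, one_mul]
    exact (h.mem_right.1.norm_sub_sub_fderiv_le _ _).trans
      (mul_le_mul_of_nonneg_right (le_max_right _ _) (sq_nonneg _))
  have hFlip : ∀ s, ‖F s - F p‖ ^ 2 ≤ (1 + e) ^ 2 * ‖s - p‖ ^ 2 := by
    intro s
    rw [← mul_pow]
    refine pow_le_pow_left₀ (norm_nonneg _) ?_ 2
    exact (norm_deformation_sub_le hr h.mem_left s p).trans (by gcongr)
  have hGlip : ∀ s, ‖s - p‖ ^ 2 ≤ (1 + e) ^ 2 * ‖F s - F p‖ ^ 2 := by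
    intro s
    rw [← mul_pow]
    refine pow_le_pow_left₀ (norm_nonneg _) ?_ 2
    have := norm_deformation_sub_le hr h.mem_right (F s) (F p)
    rw [h.leftInverse, h.leftInverse] at this
    exact this.trans (by gcongr)
  have hRε : R * ε ≤ e := by rw [hedef]; gcongr
  have hRcomp : ∀ s, |R * inner ℝ N (F s - F p) - R * inner ℝ ν (s - p)| ≤
      e * ‖F s - F p‖ ^ 2 := by
    intro s
    rw [← mul_sub, abs_mul, abs_of_pos hR]
    calc _ ≤ R * (ε * ‖F s - F p‖ ^ 2) := by gcongr; exact hcomp s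
      _ = (R * ε) * ‖F s - F p‖ ^ 2 := by ring
      _ ≤ _ := by gcongr
  have hcrit : ∀ s ∈ S, 2 * R * inner ℝ ν (s - p) ≤ ‖s - p‖ ^ 2 :=
    (mem_closestPoints_add_smul_iff.1 (hxν ▸ hp)).2
  have hcritq : 2 * R * inner ℝ ν (q - p) = ‖q - p‖ ^ 2 := by
    have h1 : ‖x - q‖ = R := by rw [← dist_eq_norm, hxq]
    have h2 : x - q = R • ν - (q - p) := by rw [hxν]; abel
    rw [h2, ← sq_eq_sq₀ (norm_nonneg _) hR.le, norm_sub_sq_real, norm_smul, hν1,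
      Real.norm_of_nonneg hR.le, inner_smul_left] at h1
    simp only [conj_trivial] at h1
    linarith
  obtain ⟨-, hk⟩ := one_eighth_le_contact_factor he0 he
  set k := 1 / (1 + e) ^ 2 - 2 * e with hkdef
  have hpos : 0 < (1 + e) ^ 2 + 2 * e := by positivity
  -- For every `s ∈ S`, `2R⟨N, F s - F p⟩ ≤ ((1 + e)² + 2e)|F s - F p|²`, which gives `τ₀`. At `s =
  -- q` the equality `hcritq` gives the lower bound `k|F q - F p|²`, hence `τ₁`.
  obtain ⟨τ, hτ₀, hτ₁, hτ⟩ := exists_mem_closure_medialAxis (A := F '' S) (p := F p) (N := N)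
    (τ₀ := R / ((1 + e) ^ 2 + 2 * e)) (τ₁ := R / k) (hS.image h).isClosed
    (div_pos hR hpos) hN0
    (by
      refine mem_closestPoints_add_smul_iff.2 ⟨⟨p, hp.1, rfl⟩, ?_⟩
      rintro _ ⟨s, hs, rfl⟩
      have h1 := (abs_le.1 (hRcomp s)).2
      have h2 := hcrit s hs
      have h3 := hGlip s
      have h4 : 2 * (R / ((1 + e) ^ 2 + 2 * e)) * inner ℝ N (F s - F p) =
          2 * (R * inner ℝ N (F s - F p)) / ((1 + e) ^ 2 + 2 * e) := by ring
      rw [h4, div_le_iff₀ hpos]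
      linarith)
    (by
      intro τ hτ hmem
      have hFq : 0 < ‖F q - F p‖ :=
        norm_pos_iff.2 (sub_ne_zero.2 fun hqp => hpq (h.leftInverse.injective hqp).symm)
      have h1 := (abs_le.1 (hRcomp q)).1
      have h2 := (mem_closestPoints_add_smul_iff.1 hmem).2 _ ⟨q, hq.1, rfl⟩
      have h3 : 1 / (1 + e) ^ 2 * ‖F q - F p‖ ^ 2 ≤ ‖q - p‖ ^ 2 := by
        rw [one_div_mul_eq_div, div_le_iff₀ (by positivity), mul_comm]
        exact hFlip q
      have hk0 : 0 < k := by linarith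
      rw [gt_iff_lt, div_lt_iff₀ hk0] at hτ
      have hτpos : 0 < τ := pos_of_mul_pos_left (hR.trans hτ) hk0.le
      have h5 : k * ‖F q - F p‖ ^ 2 ≤ 2 * (R * inner ℝ N (F q - F p)) := by
        rw [hkdef, sub_mul]; linarith
      have h6 : τ * (k * ‖F q - F p‖ ^ 2) ≤ τ * (2 * (R * inner ℝ N (F q - F p))) := by gcongr
      have h7 : R * (2 * τ * inner ℝ N (F q - F p)) ≤ R * ‖F q - F p‖ ^ 2 := by gcongr
      have h8 : R * ‖F q - F p‖ ^ 2 < τ * k * ‖F q - F p‖ ^ 2 := by gcongr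
      linarith)
  refine ⟨_, hτ, ?_⟩
  have hRτ := abs_sub_le_of_contact_bounds he0 he hR.le hτ₀ hτ₁
  -- To first order the moved foot point, the tilted normal and the changed length contribute `re`,
  -- `re` and `4re`: the coefficient `6`.
  have hdec : x - (F p + τ • N) = -φ p + -(R • (N - ν)) + (R - τ) • N := by
    have : F p = p + φ p := rfl
    rw [this, hxν, smul_sub, sub_smul]
    abel
  rw [dist_eq_norm, hdec]
  have h1 : ‖φ p‖ ≤ e * r :=
    (norm_le_of_mem_displacementFields hr h.mem_left p).trans (by gcongr)
  have h2 : ‖R • (N - ν)‖ ≤ r * e := by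
    rw [norm_smul, Real.norm_of_nonneg hR.le]
    gcongr
  have h3 : ‖(R - τ) • N‖ ≤ r * (4 * e + 128 * e ^ 2) * (1 + e) := by
    rw [norm_smul, Real.norm_eq_abs]
    gcongr
    exact hRτ.trans (by gcongr)
  refine norm_add₃_le.trans ?_
  rw [norm_neg, norm_neg]
  have h4 : (4 * e + 128 * e ^ 2) * (1 + e) ≤ 4 * e + 164 * e ^ 2 := by
    nlinarith [mul_nonneg (sq_nonneg e) (sub_nonneg.2 he)]
  have h5 : r * ((4 * e + 128 * e ^ 2) * (1 + e)) ≤ r * (4 * e + 164 * e ^ 2) := by gcongr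
  have h6 : 0 ≤ r * e ^ 2 := by positivity
  linarith

lemma infEDist_medialAxis_image_le (hS : HasBoundingSphere S z r)
    (h : IsDeformationPair z r φ ψ) (he : r * deformationSize φ ψ ≤ 1 / 4)
    {x : EuclideanSpace ℝ (Fin d)} (hx : x ∈ medialAxis S) :
    Metric.infEDist x (medialAxis (deformation φ '' S)) ≤ ENNReal.ofReal
      (r * (6 * (r * deformationSize φ ψ) + 200 * (r * deformationSize φ ψ) ^ 2)) := by
  obtain ⟨y, hy, hxy⟩ := exists_mem_closure_medialAxis_image_dist_le hS h he hx
  rw [← Metric.infEDist_closure]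
  refine (Metric.infEDist_le_edist_of_mem hy).trans ?_
  rw [edist_dist]
  exact ENNReal.ofReal_le_ofReal hxy

lemma hausdorffEDist_medialAxis_image_le (hS : HasBoundingSphere S z r)
    (h : IsDeformationPair z r φ ψ) (he : r * deformationSize φ ψ ≤ 1 / 4) :
    Metric.hausdorffEDist (medialAxis S) (medialAxis (deformation φ '' S)) ≤ ENNReal.ofReal
      (r * (6 * (r * deformationSize φ ψ) + 200 * (r * deformationSize φ ψ) ^ 2)) := by
  refine Metric.hausdorffEDist_le_of_infEDist
    (fun x hx => infEDist_medialAxis_image_le hS h he hx) fun x hx => ?_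
  -- The hypotheses are symmetric: the inverse deformation carries the image back to `S`.
  have := infEDist_medialAxis_image_le (hS.image h) h.symm
    (by rwa [deformationSize_comm]) hx
  rwa [h.image_image, deformationSize_comm] at this

lemma hausdorffEDist_medialAxis_image_le_linear (hS : HasBoundingSphere S z r)
    (h : IsDeformationPair z r φ ψ) (he : r * deformationSize φ ψ ≤ 1 / 4) :
    Metric.hausdorffEDist (medialAxis S) (medialAxis (deformation φ '' S)) ≤
      ENNReal.ofReal (56 * r ^ 2 * deformationSize φ ψ) := by
  refine (hausdorffEDist_medialAxis_image_le hS h he).trans (ENNReal.ofReal_le_ofReal ?_)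
  have hr := hS.radius_pos
  have h0 := mul_nonneg hr.le (deformationSize_nonneg φ ψ)
  have h1 : (r * deformationSize φ ψ) ^ 2 ≤ 1 / 4 * (r * deformationSize φ ψ) := by nlinarith
  calc _ ≤ r * (6 * (r * deformationSize φ ψ) + 200 * (1 / 4 * (r * deformationSize φ ψ))) := by
        gcongr
    _ = _ := by ring

/-- Both axes lie in the open ball. They are empty simultaneously, since the criterion for
nonemptiness is invariant under bijections of the ball, so the distance is never infinite. -/
lemma hausdorffEDist_medialAxis_image_le_diam (hS : HasBoundingSphere S z r)
    (h : IsDeformationPair z r φ ψ) :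
    Metric.hausdorffEDist (medialAxis S) (medialAxis (deformation φ '' S)) ≤
      ENNReal.ofReal (2 * r) := by
  have hd : ∀ x ∈ Metric.ball z r, ∀ y ∈ Metric.ball z r, edist x y ≤ ENNReal.ofReal (2 * r) := by
    intro x hx y hy
    rw [edist_dist]
    refine ENNReal.ofReal_le_ofReal ?_
    linarith [dist_triangle_right x y z, Metric.mem_ball.1 hx, Metric.mem_ball.1 hy]
  have h1 := hS.medialAxis_subset_ball
  have h2 := (hS.image h).medialAxis_subset_ball
  have hne := h.medialAxis_image_nonempty_iff hS
  refine Metric.hausdorffEDist_le_of_mem_edist (fun x hx => ?_) fun x hx => ?_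
  · obtain ⟨y, hy⟩ := hne.2 ⟨x, hx⟩
    exact ⟨y, hy, hd x (h1 hx) y (h2 hy)⟩
  · obtain ⟨y, hy⟩ := hne.1 ⟨x, hx⟩
    exact ⟨y, hy, hd x (h2 hx) y (h1 hy)⟩

lemma hausdorffEDist_medialAxis_image_image_le {M : ℝ} (hS : HasBoundingSphere S z r)
    (h₁ : IsDeformationPair z r φ₁ ψ₁) (h₂ : IsDeformationPair z r φ₂ ψ₂)
    (hM₁ : r * deformationSize φ₁ ψ₁ ≤ M) (hM₂ : r * deformationSize φ₂ ψ₂ ≤ M) :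
    Metric.hausdorffEDist (medialAxis (deformation φ₁ '' S)) (medialAxis (deformation φ₂ '' S)) ≤
      ENNReal.ofReal (56 * ((1 + M) ^ 2 + M) * r ^ 2 * lipDeriv (φ₁ - φ₂)) := by
  have hr := hS.radius_pos
  have hS₁ := hS.image h₁
  have hχ := h₁.comp hr h₂
  have hsize := h₁.deformationSize_comp_le hr h₂ hM₁ hM₂
  rw [← h₁.comp_image φ₂ S]
  set ε := deformationSize ((φ₂ - φ₁) ∘ deformation ψ₁) ((φ₁ - φ₂) ∘ deformation ψ₂)
  by_cases hε : r * ε ≤ 1 / 4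
  · refine (hausdorffEDist_medialAxis_image_le_linear hS₁ hχ hε).trans
      (ENNReal.ofReal_le_ofReal ?_)
    calc 56 * r ^ 2 * ε ≤ 56 * r ^ 2 * (((1 + M) ^ 2 + M) * lipDeriv (φ₁ - φ₂)) := by gcongr
      _ = _ := by ring
  · refine (hausdorffEDist_medialAxis_image_le_diam hS₁ hχ).trans (ENNReal.ofReal_le_ofReal ?_)
    -- A large composite deformation forces `Lip(D(φ₁ - φ₂))` to be large, so the diameter bound is
    -- already linear in it.
    have h3 : 1 / 4 ≤ r * (((1 + M) ^ 2 + M) * lipDeriv (φ₁ - φ₂)) :=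
      (not_le.1 hε).le.trans (by gcongr)
    calc 2 * r ≤ 56 * r * (1 / 4) := by linarith
      _ ≤ 56 * r * (r * (((1 + M) ^ 2 + M) * lipDeriv (φ₁ - φ₂))) := by gcongr
      _ = _ := by ring

end Stability

theorem mainTheorem2 :
    (∃ C : ℝ, 0 ≤ C ∧
      ∀ (d : ℕ) (S : Set (EuclideanSpace ℝ (Fin d))) (z : EuclideanSpace ℝ (Fin d)) (r : ℝ)
        (φ ψ : EuclideanSpace ℝ (Fin d) → EuclideanSpace ℝ (Fin d)),
        HasBoundingSphere S z r → IsDeformationPair z r φ ψ →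
        r * deformationSize φ ψ ≤ 1 / 4 →
        Metric.hausdorffEDist (medialAxis S) (medialAxis (deformation φ '' S)) ≤
          ENNReal.ofReal ((1 + Real.sqrt 50) * r ^ 2 * deformationSize φ ψ +
            C * r ^ 3 * deformationSize φ ψ ^ 2)) ∧
    (∃ C : ℝ, 0 ≤ C ∧
      ∀ (d : ℕ) (S : Set (EuclideanSpace ℝ (Fin d))) (z : EuclideanSpace ℝ (Fin d)) (r : ℝ)
        (φ ψ : EuclideanSpace ℝ (Fin d) → EuclideanSpace ℝ (Fin d)),
        HasBoundingSphere S z r → IsDeformationPair z r φ ψ →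
        r * deformationSize φ ψ ≤ 1 / 4 →
        Metric.hausdorffEDist (medialAxis S) (medialAxis (deformation φ '' S)) ≤
          ENNReal.ofReal (C * r ^ 2 * deformationSize φ ψ)) ∧
    (∀ M : ℝ, ∃ C : ℝ, 0 ≤ C ∧
      ∀ (d : ℕ) (S : Set (EuclideanSpace ℝ (Fin d))) (z : EuclideanSpace ℝ (Fin d)) (r : ℝ)
        (φ₁ ψ₁ φ₂ ψ₂ : EuclideanSpace ℝ (Fin d) → EuclideanSpace ℝ (Fin d)),
        HasBoundingSphere S z r →
        IsDeformationPair z r φ₁ ψ₁ → r * deformationSize φ₁ ψ₁ ≤ M →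
        IsDeformationPair z r φ₂ ψ₂ → r * deformationSize φ₂ ψ₂ ≤ M →
        Metric.hausdorffEDist (closure (medialAxis (deformation φ₁ '' S)))
            (closure (medialAxis (deformation φ₂ '' S))) ≤
          ENNReal.ofReal (C * r ^ 2 * lipDeriv (φ₁ - φ₂))) := by
  refine ⟨⟨200, by norm_num, fun d S z r φ ψ hS h he => ?_⟩,
    ⟨56, by norm_num, fun d S z r φ ψ hS h he =>
      hausdorffEDist_medialAxis_image_le_linear hS h he⟩,
    -- The absolute value keeps the constant nonnegative for negative `M`.
    fun M => ⟨56 * ((1 + |M|) ^ 2 + |M|), by positivity,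
      fun d S z r φ₁ ψ₁ φ₂ ψ₂ hS h₁ hM₁ h₂ hM₂ => ?_⟩⟩
  · refine (hausdorffEDist_medialAxis_image_le hS h he).trans (ENNReal.ofReal_le_ofReal ?_)
    have hsqrt : 5 ≤ Real.sqrt 50 := Real.le_sqrt_of_sq_le (by norm_num)
    have h0 : 0 ≤ r ^ 2 * deformationSize φ ψ :=
      mul_nonneg (sq_nonneg r) (deformationSize_nonneg φ ψ)
    linarith [mul_le_mul_of_nonneg_right hsqrt h0]
  · rw [Metric.hausdorffEDist_closure]
    exact hausdorffEDist_medialAxis_image_image_le hS h₁ h₂ (hM₁.trans (le_abs_self M))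
      (hM₂.trans (le_abs_self M))
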